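/- **Setting.** Let $R$ be a finite root system in $\mathbb{R}^m$, that is, a finite set of nonzero vectors with $\sigma_\alpha(R)=R$ for all $\alpha\in R$, where $\sigma_\alpha(x)=x-2\frac{\langle\alpha,x\rangle}{\langle\alpha,\alpha\rangle}\alpha$. Let $W$ be the group generated by the $\sigma_\alpha$, $S\subseteq R$ a simple system, $R_+$ the corresponding set of positive roots, and $C=\{x:\langle\alpha,x\rangle>0\ \forall\alpha\in R_+\}$ the positive Weyl chamber. Let $k:R\to[0,\infty)$ be a multiplicity function (constant on $W$-orbits). The Dunkl derivatives and the Dunkl Laplacian are $$T_if(x)=\partial_if(x)+\sum_{\alpha\in R_+}k(\alpha)\,\alpha_i\,\frac{f(x)-f(\sigma_\alpha x)}{\langle\alpha,x\rangle},\qquad \Delta_k=\sum_{i=1}^mT_i^2$$ (with the quotient extended by its limit to the hyperplane $\langle\alpha,x\rangle=0$). Let $(\phi_\tau)_{\tau\in\mathbb{N}^m}$ be a basis of the space of real polynomials on $\mathbb{R}^m$, with $\phi_\tau$ homogeneous of degree $|\tau|=\tau_1+\dots+\tau_m$, orthogonal for the pairing $$[p,q]_k=\int_{\mathbb{R}^m}e^{-\Delta_k/2}p(x)\;e^{-\Delta_k/2}q(x)\;e^{-|x|^2/2}\prod_{\alpha\in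 R_+}|\langle\alpha,x\rangle|^{2k(\alpha)}\,dx .$$ Put $H_\tau=e^{-\Delta_k/2}\phi_\tau$ and $$\phi_\tau^W(y)=\frac1{|W|}\sum_{w\in W}\phi_\tau(wy),\qquad H_\tau^W(y)=\frac1{|W|}\sum_{w\in W}H_\tau(wy),$$ $$c_\tau^W=\frac1{2^{|\tau|/2}}\int_Ce^{-|y|^2/2}H_\tau^W(y)\prod_{\alpha\in R_+}\langle\alpha,y\rangle\,dy .$$ **Proposition (an integration by part formula).** For every $\tau\in\mathbb{N}^m$, $$c_\tau^W=\frac{(-1)^{|\tau|}}{2^{|\tau|/2}}\int_C\phi_\tau^W(T_1,\dots,T_m)\bigl(e^{-|\cdot|^2/2}\bigr)(y)\prod_{\alpha\in R_+}\langle\alpha,y\rangle\,dy ,$$ where both integrals (the one here and the one defining $c_\tau^W$) converge absolutely. -/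

import Mathlib

open MeasureTheory
open scoped NNReal RealInnerProductSpace

namespace Dunkl

/-- The reflection `σ_α` in the hyperplane orthogonal to `α`. -/
noncomputable def refl {m : ℕ} (α : EuclideanSpace ℝ (Fin m)) :
    EuclideanSpace ℝ (Fin m) ≃ₗᵢ[ℝ] EuclideanSpace ℝ (Fin m) :=
  (ℝ ∙ α)ᗮ.reflection

theorem refl_apply {m : ℕ} (α x : EuclideanSpace ℝ (Fin m)) :
    refl α x = x - (2 * ⟪α, x⟫ / ⟪α, α⟫) • α := by
  unfold refl
  rw [Submodule.reflection_orthogonal_apply, Submodule.reflection_singleton_apply,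
    real_inner_self_eq_norm_sq, ← Nat.cast_smul_eq_nsmul ℝ, smul_smul, neg_sub]
  congr 2
  push_cast
  simp only [RCLike.ofReal_real_eq_id, id]
  ring

/-- A (finite) root system in `ℝ^m`: nonzero vectors, stable under the reflections in them.
It need be neither reduced, nor crystallographic, nor spanning. -/
structure RootSys (m : ℕ) where
  roots : Finset (EuclideanSpace ℝ (Fin m))
  ne_zero : ∀ α ∈ roots, α ≠ 0
  refl_image : ∀ α ∈ roots,
    refl α '' (roots : Set (EuclideanSpace ℝ (Fin m))) = roots

/-- The reflection group `W`, generated by all the `σ_α`, `α ∈ R`. -/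
noncomputable def RootSys.W {m : ℕ} (R : RootSys m) :
    Subgroup (EuclideanSpace ℝ (Fin m) ≃ₗᵢ[ℝ] EuclideanSpace ℝ (Fin m)) :=
  Subgroup.closure (refl '' (R.roots : Set (EuclideanSpace ℝ (Fin m))))

theorem RootSys.W_image {m : ℕ} (R : RootSys m)
    {w : EuclideanSpace ℝ (Fin m) ≃ₗᵢ[ℝ] EuclideanSpace ℝ (Fin m)} (hw : w ∈ R.W) :
    w '' (R.roots : Set (EuclideanSpace ℝ (Fin m))) = R.roots := by
  induction hw using Subgroup.closure_induction with
  | mem x hx => obtain ⟨α, hα, rfl⟩ := hx; exact R.refl_image α hα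
  | one => simp
  | mul x y _ _ hx hy => rw [LinearIsometryEquiv.coe_mul, Set.image_comp, hy, hx]
  | inv x _ hx =>
    conv_lhs => rw [← hx]
    rw [← Set.image_comp, ← LinearIsometryEquiv.coe_mul, inv_mul_cancel]
    simp

theorem RootSys.W_fix {m : ℕ} (R : RootSys m)
    {w : EuclideanSpace ℝ (Fin m) ≃ₗᵢ[ℝ] EuclideanSpace ℝ (Fin m)} (hw : w ∈ R.W)
    (x : EuclideanSpace ℝ (Fin m)) (hx : ∀ α ∈ R.roots, ⟪α, x⟫ = 0) : w x = x := by
  induction hw using Subgroup.closure_induction with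
  | mem y hy => obtain ⟨α, hα, rfl⟩ := hy; simp [refl_apply, hx α hα]
  | one => simp
  | mul y z _ _ hy hz => rw [LinearIsometryEquiv.coe_mul, Function.comp_apply, hz, hy]
  | inv y _ hy =>
    conv_lhs => rw [← hy]
    rw [← Function.comp_apply (f := ⇑y⁻¹), ← LinearIsometryEquiv.coe_mul, inv_mul_cancel]
    simp

instance RootSys.finite_W {m : ℕ} (R : RootSys m) : Finite R.W := by
  classical
  let F : R.W → R.roots → R.roots := fun w β =>
    ⟨w.1 β.1, by
      have h : w.1 β.1 ∈ (R.roots : Set (EuclideanSpace ℝ (Fin m))) := by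
        rw [← R.W_image w.2]; exact ⟨β.1, β.2, rfl⟩
      exact h⟩
  refine Finite.of_injective F fun w w' h => ?_
  apply Subtype.ext
  apply LinearIsometryEquiv.ext
  intro x
  let U := Submodule.span ℝ (R.roots : Set (EuclideanSpace ℝ (Fin m)))
  have hU : ∀ y ∈ U, w.1 y = w'.1 y := by
    intro y hy
    induction hy using Submodule.span_induction with
    | mem y hy => exact congrArg Subtype.val (congrFun h ⟨y, hy⟩)
    | zero => simp
    | add a b _ _ ha hb => simp [ha, hb]
    | smul c a _ ha => simp [ha]
  obtain ⟨y, hy, z, hz, rfl⟩ := U.exists_add_mem_mem_orthogonal x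
  have hz' : ∀ α ∈ R.roots, ⟪α, z⟫ = 0 := fun α hα =>
    (Submodule.mem_orthogonal U z).1 hz α (Submodule.subset_span hα)
  rw [map_add, map_add, hU y hy, R.W_fix w.2 z hz', R.W_fix w'.2 z hz']

noncomputable instance RootSys.fintype_W {m : ℕ} (R : RootSys m) : Fintype R.W :=
  Fintype.ofFinite _

/-- A simple system: a set of roots that is a basis of `span R` and such that every root is a
linear combination of it with coefficients all `≥ 0` or all `≤ 0`. -/
structure IsSimpleSystem {m : ℕ} (R : RootSys m) (S : Set (EuclideanSpace ℝ (Fin m))) :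
    Prop where
  subset : S ⊆ R.roots
  linearIndepOn : LinearIndepOn ℝ id S
  span_eq : Submodule.span ℝ S =
    Submodule.span ℝ (R.roots : Set (EuclideanSpace ℝ (Fin m)))
  pos_or_neg : ∀ α ∈ R.roots, α ∈ Submodule.span ℝ≥0 S ∨ -α ∈ Submodule.span ℝ≥0 S

open scoped Classical in
/-- The positive roots `R₊` with respect to the simple system `S`. -/
noncomputable def posRoots {m : ℕ} (R : RootSys m) (S : Set (EuclideanSpace ℝ (Fin m))) :
    Finset (EuclideanSpace ℝ (Fin m)) :=
  R.roots.filter fun α => α ∈ Submodule.span ℝ≥0 S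

/-- The positive Weyl chamber `C`. -/
def chamber {m : ℕ} (R : RootSys m) (S : Set (EuclideanSpace ℝ (Fin m))) :
    Set (EuclideanSpace ℝ (Fin m)) :=
  {x | ∀ α ∈ posRoots R S, 0 < ⟪α, x⟫}

/-- A nonnegative multiplicity function: constant on the `W`-orbits of `R`. Only its values
on `R` matter. -/
structure IsMultiplicity {m : ℕ} (R : RootSys m) (k : EuclideanSpace ℝ (Fin m) → ℝ) :
    Prop where
  nonneg : ∀ α ∈ R.roots, 0 ≤ k α
  invariant : ∀ α ∈ R.roots, ∀ w ∈ R.W, k (w α) = k α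

open scoped Classical in
/-- The quotient `(f(x) - f(σ_α x)) / ⟨α, x⟩`, extended to the hyperplane `⟨α, x⟩ = 0` by its
limit there (for differentiable `f`), `(2 / |α|²) ∂_α f(x)`. -/
noncomputable def diffQuot {m : ℕ} (α : EuclideanSpace ℝ (Fin m))
    (f : EuclideanSpace ℝ (Fin m) → ℝ) (x : EuclideanSpace ℝ (Fin m)) : ℝ :=
  if ⟪α, x⟫ = 0 then 2 / ‖α‖ ^ 2 * fderiv ℝ f x α
  else (f x - f (refl α x)) / ⟪α, x⟫

/-- The Dunkl derivative
`T_i f(x) = ∂_i f(x) + ∑_{α ∈ R₊} k(α) α_i (f(x) - f(σ_α x)) / ⟨α, x⟩`. -/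
noncomputable def T {m : ℕ} (R : RootSys m) (S : Set (EuclideanSpace ℝ (Fin m)))
    (k : EuclideanSpace ℝ (Fin m) → ℝ) (i : Fin m)
    (f : EuclideanSpace ℝ (Fin m) → ℝ) (x : EuclideanSpace ℝ (Fin m)) : ℝ :=
  fderiv ℝ f x (EuclideanSpace.single i 1) +
    ∑ α ∈ posRoots R S, k α * α i * diffQuot α f x

/-- The Dunkl Laplacian `Δ_k = ∑ T_i²`. -/
noncomputable def dunklLaplacian {m : ℕ} (R : RootSys m)
    (S : Set (EuclideanSpace ℝ (Fin m))) (k : EuclideanSpace ℝ (Fin m) → ℝ)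
    (f : EuclideanSpace ℝ (Fin m) → ℝ) (x : EuclideanSpace ℝ (Fin m)) : ℝ :=
  ∑ i, T R S k i (T R S k i f) x

/-- `T_1^{ν_1} ⋯ T_m^{ν_m} f`. -/
noncomputable def monomialT {m : ℕ} (R : RootSys m) (S : Set (EuclideanSpace ℝ (Fin m)))
    (k : EuclideanSpace ℝ (Fin m) → ℝ) (ν : Fin m →₀ ℕ)
    (f : EuclideanSpace ℝ (Fin m) → ℝ) : EuclideanSpace ℝ (Fin m) → ℝ :=
  (List.finRange m).foldr (fun i g => (T R S k i)^[ν i] g) f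

/-- `p(T_1, …, T_m) f` for a polynomial `p`. -/
noncomputable def polyT {m : ℕ} (R : RootSys m) (S : Set (EuclideanSpace ℝ (Fin m)))
    (k : EuclideanSpace ℝ (Fin m) → ℝ) (p : MvPolynomial (Fin m) ℝ)
    (f : EuclideanSpace ℝ (Fin m) → ℝ) (x : EuclideanSpace ℝ (Fin m)) : ℝ :=
  ∑ ν ∈ p.support, p.coeff ν * monomialT R S k ν f x

/-- `e^{-Δ_k/2} p = ∑_n (-1/2)^n / n! Δ_k^n p` for a polynomial `p` (the series has only
finitely many nonzero terms, as `Δ_k` lowers the degree). -/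
noncomputable def expNegHalfLaplacian {m : ℕ} (R : RootSys m)
    (S : Set (EuclideanSpace ℝ (Fin m))) (k : EuclideanSpace ℝ (Fin m) → ℝ)
    (p : MvPolynomial (Fin m) ℝ) (x : EuclideanSpace ℝ (Fin m)) : ℝ :=
  ∑' n : ℕ, (-1 / 2 : ℝ) ^ n / (n.factorial : ℝ) *
    ((dunklLaplacian R S k)^[n] fun y => MvPolynomial.eval (fun i => y i) p) x

/-- The pairing `[p, q]_k`, up to its constant factor: the scalar product of `e^{-Δ_k/2} p` and
`e^{-Δ_k/2} q` with respect to the weight `e^{-|x|²/2} ∏_{α ∈ R₊} |⟨α, x⟩|^{2 k(α)}`. -/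
noncomputable def pairing {m : ℕ} (R : RootSys m) (S : Set (EuclideanSpace ℝ (Fin m)))
    (k : EuclideanSpace ℝ (Fin m) → ℝ) (p q : MvPolynomial (Fin m) ℝ) : ℝ :=
  ∫ x : EuclideanSpace ℝ (Fin m),
    expNegHalfLaplacian R S k p x * expNegHalfLaplacian R S k q x *
      (Real.exp (-‖x‖ ^ 2 / 2) * ∏ α ∈ posRoots R S, |⟪α, x⟫| ^ (2 * k α))

/-- `(φ_τ)` is an orthogonal basis of the space of polynomials for the pairing, with `φ_τ`
homogeneous of degree `|τ|`. -/
structure IsHomogeneousOrthogonalBasis {m : ℕ} (R : RootSys m)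
    (S : Set (EuclideanSpace ℝ (Fin m))) (k : EuclideanSpace ℝ (Fin m) → ℝ)
    (φ : (Fin m → ℕ) → MvPolynomial (Fin m) ℝ) : Prop where
  homogeneous : ∀ τ, (φ τ).IsHomogeneous (∑ i, τ i)
  linearIndependent : LinearIndependent ℝ φ
  span_eq_top : Submodule.span ℝ (Set.range φ) = ⊤
  orthogonal : ∀ τ τ', τ ≠ τ' → pairing R S k (φ τ) (φ τ') = 0

/-- The polynomial `y ↦ p(w y)`. -/
noncomputable def polyComp {m : ℕ}
    (w : EuclideanSpace ℝ (Fin m) ≃ₗᵢ[ℝ] EuclideanSpace ℝ (Fin m))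
    (p : MvPolynomial (Fin m) ℝ) : MvPolynomial (Fin m) ℝ :=
  MvPolynomial.aeval (fun i => ∑ j, MvPolynomial.C (w (EuclideanSpace.single j 1) i) *
    (MvPolynomial.X j : MvPolynomial (Fin m) ℝ)) p

theorem eval_polyComp {m : ℕ}
    (w : EuclideanSpace ℝ (Fin m) ≃ₗᵢ[ℝ] EuclideanSpace ℝ (Fin m))
    (p : MvPolynomial (Fin m) ℝ) (y : EuclideanSpace ℝ (Fin m)) :
    MvPolynomial.eval (fun i => y i) (polyComp w p) =
      MvPolynomial.eval (fun i => w y i) p := by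
  have hy : w y = ∑ j, y j • w (EuclideanSpace.single j 1) := by
    have h : y = ∑ j, y j • EuclideanSpace.single j (1 : ℝ) := by
      ext i; simp [Finset.sum_apply, Pi.single_apply]
    conv_lhs => rw [h]
    rw [map_sum]
    simp only [map_smul]
  unfold polyComp
  induction p using MvPolynomial.induction_on with
  | C a => simp
  | add p q hp hq => simp only [map_add, hp, hq]
  | mul_X p i hp =>
    rw [map_mul, map_mul, map_mul, hp, hy]
    simp [mul_comm]

/-- `φ^W(y) = |W|⁻¹ ∑_{w ∈ W} φ(w y)`, as a polynomial. -/
noncomputable def polyW {m : ℕ} (R : RootSys m) (p : MvPolynomial (Fin m) ℝ) :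
    MvPolynomial (Fin m) ℝ :=
  (Fintype.card R.W : ℝ)⁻¹ • ∑ w : R.W, polyComp w.1 p

/-- The Dunkl–Hermite polynomial `H_τ = e^{-Δ_k/2} φ_τ`. -/
noncomputable def hermite {m : ℕ} (R : RootSys m) (S : Set (EuclideanSpace ℝ (Fin m)))
    (k : EuclideanSpace ℝ (Fin m) → ℝ) (φ : (Fin m → ℕ) → MvPolynomial (Fin m) ℝ)
    (τ : Fin m → ℕ) (x : EuclideanSpace ℝ (Fin m)) : ℝ :=
  expNegHalfLaplacian R S k (φ τ) x

/-- The `W`-invariant Dunkl–Hermite polynomial, normalised like `φ_τ^W`: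
`H_τ^W(x) = |W|⁻¹ ∑_{w ∈ W} H_τ(w x)`. -/
noncomputable def hermiteW {m : ℕ} (R : RootSys m) (S : Set (EuclideanSpace ℝ (Fin m)))
    (k : EuclideanSpace ℝ (Fin m) → ℝ) (φ : (Fin m → ℕ) → MvPolynomial (Fin m) ℝ)
    (τ : Fin m → ℕ) (x : EuclideanSpace ℝ (Fin m)) : ℝ :=
  (Fintype.card R.W : ℝ)⁻¹ * ∑ w : R.W, hermite R S k φ τ (w.1 x)

/-- `c_τ^W = 2^{-|τ|/2} ∫_C e^{-|y|²/2} H_τ^W(y) ∏_{α ∈ R₊} ⟨α, y⟩ dy`. -/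
noncomputable def coeffW {m : ℕ} (R : RootSys m) (S : Set (EuclideanSpace ℝ (Fin m)))
    (k : EuclideanSpace ℝ (Fin m) → ℝ) (φ : (Fin m → ℕ) → MvPolynomial (Fin m) ℝ)
    (τ : Fin m → ℕ) : ℝ :=
  (2 : ℝ) ^ (-((∑ i, τ i : ℕ) : ℝ) / 2) *
    ∫ y in chamber R S, Real.exp (-‖y‖ ^ 2 / 2) * hermiteW R S k φ τ y *
      ∏ α ∈ posRoots R S, ⟪α, y⟫

end Dunkl

/-! No integration by parts takes place: the two integrands agree pointwise up to the sign
$(-1)^{|\tau|}$. The reason is the Rodrigues formula `polyT_gaussian`, applied to the homogeneous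
polynomial $\phi_\tau^W$. Since $\Delta_k$ commutes with $W$ (`dunklLaplacian_comp`), averaging over
$W$ may be done before or after $e^{-\Delta_k/2}$, so that $H_\tau^W=e^{-\Delta_k/2}\phi_\tau^W$
(`hermiteW_eq`).

The Rodrigues formula rests on two rules. The Gaussian $G=e^{-|x|^2/2}$ is invariant under
reflections, hence $T_i(Gg)=G\,(T_i-x_i)g$ (`T_gaussian_mul`). On polynomials
$e^{-\Delta_k/2}x_i=(x_i-T_i)e^{-\Delta_k/2}$ (`expLap_coord_mul`). Together,
$T_i(G\,e^{-\Delta_k/2}f)=-G\,e^{-\Delta_k/2}(x_if)$: each $T_i$ acts as multiplication by $-x_i$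
under the exponential.

The second rule follows from $[\Delta_k,x_l]=2T_l$ and $[\Delta_k,T_l]=0$, the latter being a
consequence of Dunkl's theorem `T_comm`. Both are obtained from
$[T_i,x_l]=\delta_{il}+\sum_{\alpha\in R}k(\alpha)|\alpha|^{-2}\alpha_i\alpha_l\,\sigma_\alpha$
(`T_coord_mul`) and the equivariance `T_comp`. Absolute convergence holds because a polynomial times
$G$ is integrable on all of $\mathbb{R}^m$. -/

namespace Dunkl

/-! ### Polynomial functions: induction principle, closure properties, integrability against the
Gaussian. -/

section PolynomialFunctions

variable {m : ℕ}

/-- The algebra of polynomial functions on `ℝ^m`. -/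
noncomputable def polyFun (m : ℕ) : Subalgebra ℝ (EuclideanSpace ℝ (Fin m) → ℝ) :=
  (MvPolynomial.aeval (R := ℝ)
    (fun (i : Fin m) (x : EuclideanSpace ℝ (Fin m)) => x i)).range

theorem aeval_coord (p : MvPolynomial (Fin m) ℝ) :
    MvPolynomial.aeval (R := ℝ) (fun (i : Fin m) (x : EuclideanSpace ℝ (Fin m)) => x i) p =
      fun x => MvPolynomial.eval (fun i => x i) p := by
  induction p using MvPolynomial.induction_on with
  | C a => ext x; simp
  | add p q hp hq => ext x; simp [hp, hq]
  | mul_X p i hp => ext x; simp [hp]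

theorem eval_mem_polyFun (p : MvPolynomial (Fin m) ℝ) :
    (fun x : EuclideanSpace ℝ (Fin m) => MvPolynomial.eval (fun i => x i) p) ∈ polyFun m :=
  ⟨p, aeval_coord p⟩

theorem exists_eval_of_mem_polyFun {f : EuclideanSpace ℝ (Fin m) → ℝ} (hf : f ∈ polyFun m) :
    ∃ p : MvPolynomial (Fin m) ℝ, f = fun x => MvPolynomial.eval (fun i => x i) p := by
  obtain ⟨p, rfl⟩ := hf
  exact ⟨p, aeval_coord p⟩

theorem const_mem_polyFun (c : ℝ) :
    (fun _ : EuclideanSpace ℝ (Fin m) => c) ∈ polyFun m := by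
  simpa using eval_mem_polyFun (m := m) (MvPolynomial.C c)

theorem coord_mem_polyFun (i : Fin m) :
    (fun x : EuclideanSpace ℝ (Fin m) => x i) ∈ polyFun m := by
  simpa using eval_mem_polyFun (m := m) (MvPolynomial.X i)

theorem coord_mul_mem_polyFun {f : EuclideanSpace ℝ (Fin m) → ℝ} (hf : f ∈ polyFun m)
    (i : Fin m) : (fun x => x i * f x) ∈ polyFun m :=
  mul_mem (coord_mem_polyFun i) hf

theorem const_mul_mem_polyFun {f : EuclideanSpace ℝ (Fin m) → ℝ} (hf : f ∈ polyFun m)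
    (c : ℝ) : (fun x => c * f x) ∈ polyFun m :=
  mul_mem (const_mem_polyFun c) hf

theorem add_mem_polyFun {f g : EuclideanSpace ℝ (Fin m) → ℝ} (hf : f ∈ polyFun m)
    (hg : g ∈ polyFun m) : (fun x => f x + g x) ∈ polyFun m :=
  add_mem hf hg

-- Constants, sums and multiplication by one coordinate generate everything, so a claim about an
-- operator on polynomials reduces to how the operator commutes with $x_i$.
@[elab_as_elim]
theorem polyFun_induction {P : ∀ f : EuclideanSpace ℝ (Fin m) → ℝ, f ∈ polyFun m → Prop}
    (const : ∀ c : ℝ, P (fun _ => c) (const_mem_polyFun c))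
    (add : ∀ f (hf : f ∈ polyFun m) g (hg : g ∈ polyFun m), P f hf → P g hg →
      P (fun x => f x + g x) (add_mem_polyFun hf hg))
    (coord_mul : ∀ i f (hf : f ∈ polyFun m), P f hf →
      P (fun x => x i * f x) (coord_mul_mem_polyFun hf i))
    {f : EuclideanSpace ℝ (Fin m) → ℝ} (hf : f ∈ polyFun m) : P f hf := by
  obtain ⟨p, rfl⟩ := exists_eval_of_mem_polyFun hf
  induction p using MvPolynomial.induction_on with
  | C a => simpa using const a
  | add p q hp hq =>
    simpa using add _ (eval_mem_polyFun p) _ (eval_mem_polyFun q) (hp _) (hq _)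
  | mul_X p i hp => simpa [mul_comm] using coord_mul i _ (eval_mem_polyFun p) (hp _)

theorem sum_mem_polyFun {ι : Type*} {s : Finset ι} {f : ι → EuclideanSpace ℝ (Fin m) → ℝ}
    (hf : ∀ a ∈ s, f a ∈ polyFun m) : (fun x => ∑ a ∈ s, f a x) ∈ polyFun m := by
  simpa [Finset.sum_fn] using sum_mem hf

theorem prod_mem_polyFun {ι : Type*} {s : Finset ι} {f : ι → EuclideanSpace ℝ (Fin m) → ℝ}
    (hf : ∀ a ∈ s, f a ∈ polyFun m) : (fun x => ∏ a ∈ s, f a x) ∈ polyFun m := by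
  simpa [Finset.prod_fn] using prod_mem hf

theorem inner_mem_polyFun (α : EuclideanSpace ℝ (Fin m)) :
    (fun x => ⟪α, x⟫) ∈ polyFun m := by
  simp only [PiLp.inner_apply, RCLike.inner_apply, conj_trivial]
  exact sum_mem_polyFun fun i _ => mul_mem (coord_mem_polyFun i) (const_mem_polyFun (α i))

theorem comp_mem_polyFun {f : EuclideanSpace ℝ (Fin m) → ℝ} (hf : f ∈ polyFun m)
    (w : EuclideanSpace ℝ (Fin m) ≃ₗᵢ[ℝ] EuclideanSpace ℝ (Fin m)) :
    (fun x => f (w x)) ∈ polyFun m := by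
  obtain ⟨p, rfl⟩ := exists_eval_of_mem_polyFun hf
  simpa only [eval_polyComp] using eval_mem_polyFun (polyComp w p)

theorem differentiable_of_mem_polyFun {f : EuclideanSpace ℝ (Fin m) → ℝ}
    (hf : f ∈ polyFun m) : Differentiable ℝ f := by
  induction hf using polyFun_induction with
  | const c => fun_prop
  | add f _ g _ hf hg => fun_prop
  | coord_mul i f _ hf => fun_prop

/-- Quantifying over all $\varepsilon$ is what closes the induction: a product spends
$\varepsilon/2$ on each factor. -/
theorem exists_abs_le_mul_exp_of_mem_polyFun {f : EuclideanSpace ℝ (Fin m) → ℝ}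
    (hf : f ∈ polyFun m) : ∀ ε > 0, ∃ C, ∀ x, |f x| ≤ C * Real.exp (ε * ‖x‖ ^ 2) := by
  induction hf using polyFun_induction with
  | const c =>
    refine fun ε hε => ⟨|c|, fun x => le_mul_of_one_le_right (abs_nonneg c) ?_⟩
    exact Real.one_le_exp (by positivity)
  | add f _ g _ hf hg =>
    intro ε hε
    obtain ⟨C, hC⟩ := hf ε hε
    obtain ⟨D, hD⟩ := hg ε hε
    refine ⟨C + D, fun x => (abs_add_le _ _).trans ?_⟩
    linarith [hC x, hD x]
  | coord_mul i f _ hf =>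
    intro ε hε
    obtain ⟨C, hC⟩ := hf (ε / 2) (by positivity)
    -- With $t=\varepsilon|x|^2/2$ one has $|x|\le 1+|x|^2=1+\tfrac2\varepsilon
    -- t\le(1+\tfrac2\varepsilon)e^t$.
    refine ⟨(1 + 2 / ε) * C, fun x => ?_⟩
    have h1 : |x i| ≤ ‖x‖ := by simpa using PiLp.norm_apply_le x i
    have h2 : ‖x‖ ≤ (1 + 2 / ε) * Real.exp (ε / 2 * ‖x‖ ^ 2) := by
      have h3 : ‖x‖ ≤ 1 + ‖x‖ ^ 2 := by nlinarith [sq_nonneg (‖x‖ - 1), sq_nonneg ‖x‖]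
      have h4 := Real.add_one_le_exp (ε / 2 * ‖x‖ ^ 2)
      have h5 : ‖x‖ ^ 2 = 2 / ε * (ε / 2 * ‖x‖ ^ 2) := by field_simp
      have h6 : 2 / ε * (ε / 2 * ‖x‖ ^ 2) ≤ 2 / ε * Real.exp (ε / 2 * ‖x‖ ^ 2) := by
        gcongr; linarith
      have h7 : 1 ≤ Real.exp (ε / 2 * ‖x‖ ^ 2) := Real.one_le_exp (by positivity)
      linarith
    calc |x i * f x| = |x i| * |f x| := abs_mul _ _
      _ ≤ ((1 + 2 / ε) * Real.exp (ε / 2 * ‖x‖ ^ 2)) * (C * Real.exp (ε / 2 * ‖x‖ ^ 2)) := by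
        gcongr
        · exact h1.trans h2
        · exact hC x
      _ = (1 + 2 / ε) * C * Real.exp (ε * ‖x‖ ^ 2) := by
        rw [show ε * ‖x‖ ^ 2 = ε / 2 * ‖x‖ ^ 2 + ε / 2 * ‖x‖ ^ 2 by ring, Real.exp_add]
        ring

theorem integrable_gaussian_mul_of_mem_polyFun {f : EuclideanSpace ℝ (Fin m) → ℝ}
    (hf : f ∈ polyFun m) : Integrable fun x => Real.exp (-‖x‖ ^ 2 / 2) * f x := by
  -- Any $\varepsilon<1/2$ would do; $1/4$ leaves the integrable bound $e^{-|x|^2/4}$.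
  obtain ⟨C, hC⟩ := exists_abs_le_mul_exp_of_mem_polyFun hf (1 / 4) (by norm_num)
  have hg : Integrable fun x : EuclideanSpace ℝ (Fin m) => Real.exp (-(1 / 4) * ‖x‖ ^ 2) := by
    have h := (GaussianFourier.integrable_cexp_neg_mul_sq_norm_add
      (V := EuclideanSpace ℝ (Fin m)) (b := 1 / 4) (by norm_num) 0 0).norm
    refine h.congr (.of_forall fun x => ?_)
    simp only [Complex.norm_exp]
    congr 1
    norm_num [← Complex.ofReal_pow]
  refine (hg.const_mul C).mono' ?_ (.of_forall fun x => ?_)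
  · have := (differentiable_of_mem_polyFun hf).continuous
    exact Continuous.aestronglyMeasurable (by fun_prop)
  · rw [norm_mul, Real.norm_eq_abs, Real.norm_eq_abs, Real.abs_exp]
    calc Real.exp (-‖x‖ ^ 2 / 2) * |f x|
        ≤ Real.exp (-‖x‖ ^ 2 / 2) * (C * Real.exp (1 / 4 * ‖x‖ ^ 2)) := by gcongr; exact hC x
      _ = C * Real.exp (-(1 / 4) * ‖x‖ ^ 2) := by
        rw [mul_left_comm, ← Real.exp_add]
        ring_nf

end PolynomialFunctions

/-! ### Reflections and the difference quotient. -/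

section DifferenceQuotient

variable {m : ℕ}

theorem refl_apply_coord (α x : EuclideanSpace ℝ (Fin m)) (i : Fin m) :
    refl α x i = x i - 2 * ⟪α, x⟫ / ⟪α, α⟫ * α i := by
  rw [refl_apply]; simp

theorem refl_eq_self {α x : EuclideanSpace ℝ (Fin m)} (h : ⟪α, x⟫ = 0) : refl α x = x := by
  rw [refl_apply, h]; simp

theorem refl_neg (α : EuclideanSpace ℝ (Fin m)) : refl (-α) = refl α := by
  ext x; simp [refl_apply, neg_div]

theorem refl_map (w : EuclideanSpace ℝ (Fin m) ≃ₗᵢ[ℝ] EuclideanSpace ℝ (Fin m))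
    (α x : EuclideanSpace ℝ (Fin m)) : refl (w α) (w x) = w (refl α x) := by
  simp [refl_apply]

theorem diffQuot_const (α x : EuclideanSpace ℝ (Fin m)) (c : ℝ) :
    diffQuot α (fun _ => c) x = 0 := by
  simp [diffQuot]

theorem diffQuot_add {f g : EuclideanSpace ℝ (Fin m) → ℝ} (hf : Differentiable ℝ f)
    (hg : Differentiable ℝ g) (α x : EuclideanSpace ℝ (Fin m)) :
    diffQuot α (fun y => f y + g y) x = diffQuot α f x + diffQuot α g x := by
  unfold diffQuot
  split_ifs
  · rw [fderiv_fun_add (hf x) (hg x)]; simp; ring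
  · ring

theorem diffQuot_const_mul {f : EuclideanSpace ℝ (Fin m) → ℝ} (hf : Differentiable ℝ f) (c : ℝ)
    (α x : EuclideanSpace ℝ (Fin m)) :
    diffQuot α (fun y => c * f y) x = c * diffQuot α f x := by
  unfold diffQuot
  split_ifs
  · rw [fderiv_const_mul (hf x)]; simp; ring
  · ring

theorem fderiv_mul_apply' {f g : EuclideanSpace ℝ (Fin m) → ℝ} (hf : Differentiable ℝ f)
    (hg : Differentiable ℝ g) (x v : EuclideanSpace ℝ (Fin m)) :
    fderiv ℝ (fun y => f y * g y) x v = f x * fderiv ℝ g x v + g x * fderiv ℝ f x v := by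
  rw [fderiv_fun_mul (hf x) (hg x)]; simp

theorem fderiv_coord (i : Fin m) (x v : EuclideanSpace ℝ (Fin m)) :
    fderiv ℝ (fun y : EuclideanSpace ℝ (Fin m) => y i) x v = v i := by
  have := (EuclideanSpace.proj (𝕜 := ℝ) i : EuclideanSpace ℝ (Fin m) →L[ℝ] ℝ).hasFDerivAt (x := x)
  exact congrArg (fun L => L v) this.fderiv

/-- Off the hyperplane this is $(\sigma_\alpha x)_i=x_i-2\langle\alpha,x\rangle\alpha_i/|\alpha|^2$
inserted in the quotient. On it, the Leibniz rule for $\partial_\alpha$ gives the same formula,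
since $\sigma_\alpha x=x$ there. -/
theorem diffQuot_coord_mul {α : EuclideanSpace ℝ (Fin m)} (hα : α ≠ 0)
    {f : EuclideanSpace ℝ (Fin m) → ℝ} (hf : Differentiable ℝ f) (i : Fin m)
    (x : EuclideanSpace ℝ (Fin m)) :
    diffQuot α (fun y => y i * f y) x =
      x i * diffQuot α f x + 2 / ‖α‖ ^ 2 * α i * f (refl α x) := by
  have hα' : ‖α‖ ≠ 0 := norm_ne_zero_iff.2 hα
  unfold diffQuot
  split_ifs with h
  · rw [fderiv_mul_apply' (by fun_prop) hf, fderiv_coord, refl_eq_self h]; ring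
  · simp only [refl_apply_coord, real_inner_self_eq_norm_sq]
    field_simp
    ring

theorem diffQuot_neg (α : EuclideanSpace ℝ (Fin m)) (f : EuclideanSpace ℝ (Fin m) → ℝ)
    (x : EuclideanSpace ℝ (Fin m)) : diffQuot (-α) f x = -diffQuot α f x := by
  unfold diffQuot
  simp only [inner_neg_left, neg_eq_zero, refl_neg, norm_neg, map_neg, div_neg]
  split_ifs <;> ring

theorem fderiv_comp_isometry {f : EuclideanSpace ℝ (Fin m) → ℝ} (hf : Differentiable ℝ f)
    (w : EuclideanSpace ℝ (Fin m) ≃ₗᵢ[ℝ] EuclideanSpace ℝ (Fin m))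
    (x v : EuclideanSpace ℝ (Fin m)) :
    fderiv ℝ (fun y => f (w y)) x v = fderiv ℝ f (w x) (w v) := by
  have hw : HasFDerivAt (fun y => w y) (w.toContinuousLinearEquiv : _ →L[ℝ] _) x :=
    w.toContinuousLinearEquiv.hasFDerivAt
  exact congrArg (fun L => L v) ((hf (w x)).hasFDerivAt.comp x hw).fderiv

theorem diffQuot_comp {f : EuclideanSpace ℝ (Fin m) → ℝ} (hf : Differentiable ℝ f)
    (w : EuclideanSpace ℝ (Fin m) ≃ₗᵢ[ℝ] EuclideanSpace ℝ (Fin m))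
    (α x : EuclideanSpace ℝ (Fin m)) :
    diffQuot α (fun y => f (w y)) x = diffQuot (w α) f (w x) := by
  unfold diffQuot
  simp only [fderiv_comp_isometry hf, LinearIsometryEquiv.inner_map_map,
    LinearIsometryEquiv.norm_map, refl_map]

/-- Multiplication by a function that is invariant under `σ_α`. -/
theorem diffQuot_mul_of_invariant {f g : EuclideanSpace ℝ (Fin m) → ℝ}
    (hf : Differentiable ℝ f) (hg : Differentiable ℝ g) {α : EuclideanSpace ℝ (Fin m)}
    (hinv : ∀ y, g (refl α y) = g y) (x : EuclideanSpace ℝ (Fin m))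
    (hD : ⟪α, x⟫ = 0 → fderiv ℝ g x α = 0) :
    diffQuot α (fun y => g y * f y) x = g x * diffQuot α f x := by
  unfold diffQuot
  split_ifs with h
  · rw [fderiv_mul_apply' hg hf, hD h]; ring
  · simp only [hinv]; ring

/-- The product rule `diffQuot_coord_mul` contains no division by $\langle\alpha,x\rangle$, so
induction replaces a divisibility argument. -/
theorem diffQuot_mem_polyFun {α : EuclideanSpace ℝ (Fin m)} (hα : α ≠ 0)
    {f : EuclideanSpace ℝ (Fin m) → ℝ} (hf : f ∈ polyFun m) : diffQuot α f ∈ polyFun m := by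
  induction hf using polyFun_induction with
  | const c => simpa only [funext fun x => diffQuot_const α x c] using const_mem_polyFun 0
  | add f hf g hg hf' hg' =>
    rw [funext fun x => diffQuot_add (differentiable_of_mem_polyFun hf)
      (differentiable_of_mem_polyFun hg) α x]
    exact add_mem_polyFun hf' hg'
  | coord_mul i f hf hf' =>
    rw [funext fun x => diffQuot_coord_mul hα (differentiable_of_mem_polyFun hf) i x]
    exact add_mem_polyFun (coord_mul_mem_polyFun hf' i)
      (const_mul_mem_polyFun (comp_mem_polyFun hf (refl α)) _)

theorem fderiv_mem_polyFun {f : EuclideanSpace ℝ (Fin m) → ℝ} (hf : f ∈ polyFun m)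
    (v : EuclideanSpace ℝ (Fin m)) : (fun x => fderiv ℝ f x v) ∈ polyFun m := by
  induction hf using polyFun_induction with
  | const c => simpa using const_mem_polyFun 0
  | add f hf g hg hf' hg' =>
    rw [funext fun x => congrArg (fun L => L v) (fderiv_fun_add
      (differentiable_of_mem_polyFun hf x) (differentiable_of_mem_polyFun hg x))]
    exact add_mem_polyFun hf' hg'
  | coord_mul i f hf hf' =>
    rw [funext fun x => fderiv_mul_apply' (by fun_prop) (differentiable_of_mem_polyFun hf) x v]
    refine add_mem_polyFun (coord_mul_mem_polyFun hf' i) ?_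
    simp only [fderiv_coord]
    exact mul_mem hf (const_mem_polyFun (v i))

end DifferenceQuotient

/-! ### Dunkl derivatives: linearity, product rule with a coordinate, equivariance under $W$. -/

section Operators

variable {m : ℕ} {R : RootSys m} {S : Set (EuclideanSpace ℝ (Fin m))}
  {k : EuclideanSpace ℝ (Fin m) → ℝ}

theorem posRoots_subset (R : RootSys m) (S : Set (EuclideanSpace ℝ (Fin m))) :
    posRoots R S ⊆ R.roots := by
  classical exact fun α hα => (Finset.mem_filter.1 hα).1

theorem RootSys.refl_mem_W (R : RootSys m) {α : EuclideanSpace ℝ (Fin m)}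
    (hα : α ∈ R.roots) : refl α ∈ R.W :=
  Subgroup.subset_closure ⟨α, hα, rfl⟩

theorem RootSys.map_mem_roots (R : RootSys m)
    {w : EuclideanSpace ℝ (Fin m) ≃ₗᵢ[ℝ] EuclideanSpace ℝ (Fin m)} (hw : w ∈ R.W)
    {α : EuclideanSpace ℝ (Fin m)} (hα : α ∈ R.roots) : w α ∈ R.roots := by
  have h : w α ∈ (R.roots : Set (EuclideanSpace ℝ (Fin m))) := by
    rw [← R.W_image hw]; exact ⟨α, hα, rfl⟩
  exact h

theorem refl_self {α : EuclideanSpace ℝ (Fin m)} (hα : α ≠ 0) : refl α α = -α := by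
  have h : ⟪α, α⟫ ≠ 0 := inner_self_ne_zero.2 hα
  rw [refl_apply, mul_div_assoc, div_self h, mul_one, two_smul]
  abel

theorem RootSys.neg_mem_roots (R : RootSys m) {α : EuclideanSpace ℝ (Fin m)}
    (hα : α ∈ R.roots) : -α ∈ R.roots := by
  rw [← refl_self (R.ne_zero α hα)]
  exact R.map_mem_roots (R.refl_mem_W hα) hα

theorem IsMultiplicity.neg (hk : IsMultiplicity R k) {α : EuclideanSpace ℝ (Fin m)}
    (hα : α ∈ R.roots) : k (-α) = k α := by
  rw [← refl_self (R.ne_zero α hα)]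
  exact hk.invariant α hα _ (R.refl_mem_W hα)

/-- A vector and its opposite are nonnegative combinations of a linearly independent set only if
the vector vanishes. -/
theorem eq_zero_of_mem_span_nnreal_of_neg_mem {E : Type*} [AddCommGroup E] [Module ℝ E] {S : Set E}
    (hS : LinearIndepOn ℝ id S) {α : E} (h : α ∈ Submodule.span ℝ≥0 S)
    (h' : -α ∈ Submodule.span ℝ≥0 S) : α = 0 := by
  obtain ⟨c, hc, rfl⟩ := (Submodule.mem_span_set (R := ℝ≥0)).1 h
  obtain ⟨d, hd, hcd⟩ := (Submodule.mem_span_set (R := ℝ≥0)).1 h'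
  -- Adding the expansions of $\alpha$ and $-\alpha$ gives a relation on $S$ with coefficients
  -- $c+d$. These vanish by independence, and then $c=0$ by nonnegativity.
  have key := linearIndepOn_iff.1 hS
    ((c + d).mapRange (fun r : ℝ≥0 => (r : ℝ)) NNReal.coe_zero) ?_ ?_
  · have h0 : c = 0 := by
      ext x
      have := DFunLike.congr_fun key x
      simp only [Finsupp.mapRange_apply, Finsupp.add_apply, NNReal.coe_add,
        Finsupp.coe_zero, Pi.zero_apply] at this ⊢
      have h1 := (c x).coe_nonneg
      have h2 := (d x).coe_nonneg
      push_cast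
      linarith
    simp [h0]
  · rw [Finsupp.mem_supported]
    intro x hx
    have hx' : (c + d) x ≠ 0 := by
      intro h0
      simp [Finsupp.mapRange_apply, h0] at hx
    have : c x ≠ 0 ∨ d x ≠ 0 := by
      by_contra! h0
      exact hx' (by simp [h0.1, h0.2])
    rcases this with h0 | h0
    · exact hc (by simpa using h0)
    · exact hd (by simpa using h0)
  · have e : ∀ c : E →₀ ℝ≥0, (Finsupp.linearCombination ℝ id)
        (c.mapRange (fun r : ℝ≥0 => (r : ℝ)) NNReal.coe_zero) = c.sum fun mi r => r • mi := by
      intro c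
      rw [Finsupp.linearCombination_apply, Finsupp.sum_mapRange_index (by simp)]
      rfl
    rw [e, Finsupp.sum_add_index' (by simp) (by intros; exact add_smul _ _ _), hcd]
    exact add_neg_cancel _

/-- The map $\alpha\mapsto-\alpha$ exchanges positive and remaining roots. Sums over all of $R$ are
preferable because $W$ permutes $R$ but not $R_+$. -/
theorem sum_posRoots_eq_half (hS : IsSimpleSystem R S) {F : EuclideanSpace ℝ (Fin m) → ℝ}
    (hF : ∀ α ∈ R.roots, F (-α) = F α) :
    ∑ α ∈ posRoots R S, F α = ∑ α ∈ R.roots, F α / 2 := by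
  classical
  have h1 := Finset.sum_filter_add_sum_filter_not R.roots
    (fun α => α ∈ Submodule.span ℝ≥0 S) F
  have h2 : ∑ α ∈ R.roots.filter (fun α => α ∉ Submodule.span ℝ≥0 S), F α =
      ∑ α ∈ R.roots.filter (fun α => α ∈ Submodule.span ℝ≥0 S), F α := by
    refine Finset.sum_nbij' (fun α => -α) (fun α => -α) ?_ ?_ ?_ ?_ ?_
    · intro α hα
      rw [Finset.mem_filter] at hα ⊢
      exact ⟨R.neg_mem_roots hα.1, (hS.pos_or_neg α hα.1).resolve_left hα.2⟩
    · intro α hα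
      rw [Finset.mem_filter] at hα ⊢
      exact ⟨R.neg_mem_roots hα.1, fun h => R.ne_zero α hα.1
        (eq_zero_of_mem_span_nnreal_of_neg_mem hS.linearIndepOn hα.2 h)⟩
    · simp
    · simp
    · intro α hα
      exact (hF α (Finset.mem_filter.1 hα).1).symm
  rw [← Finset.sum_div, ← h1, h2, add_self_div_two, posRoots]

/-- The summand is even in $\alpha$: $k$ is even, while $\alpha_i$ and the difference quotient are
both odd. -/
theorem T_eq_sum_roots (hS : IsSimpleSystem R S) (hk : IsMultiplicity R k) (i : Fin m)
    (f : EuclideanSpace ℝ (Fin m) → ℝ) (x : EuclideanSpace ℝ (Fin m)) :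
    T R S k i f x = fderiv ℝ f x (EuclideanSpace.single i 1) +
      ∑ α ∈ R.roots, k α * α i * diffQuot α f x / 2 := by
  rw [T, sum_posRoots_eq_half hS]
  intro α hα
  rw [hk.neg hα, diffQuot_neg]
  simp

theorem T_mem_polyFun (R : RootSys m) (S : Set (EuclideanSpace ℝ (Fin m)))
    (k : EuclideanSpace ℝ (Fin m) → ℝ) (i : Fin m) {f : EuclideanSpace ℝ (Fin m) → ℝ}
    (hf : f ∈ polyFun m) : T R S k i f ∈ polyFun m :=
  add_mem_polyFun (fderiv_mem_polyFun hf _) (sum_mem_polyFun fun α hα =>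
    const_mul_mem_polyFun (diffQuot_mem_polyFun (R.ne_zero α (posRoots_subset R S hα)) hf) _)

theorem T_const (i : Fin m) (c : ℝ) : T R S k i (fun _ => c) = fun _ => 0 := by
  funext x; simp [T, diffQuot_const]

theorem T_add (i : Fin m) {f g : EuclideanSpace ℝ (Fin m) → ℝ} (hf : Differentiable ℝ f)
    (hg : Differentiable ℝ g) :
    T R S k i (fun y => f y + g y) = fun x => T R S k i f x + T R S k i g x := by
  funext x
  simp only [T, diffQuot_add hf hg, fderiv_fun_add (hf x) (hg x), mul_add,
    Finset.sum_add_distrib, add_apply]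
  ring

theorem T_const_mul (i : Fin m) {f : EuclideanSpace ℝ (Fin m) → ℝ} (hf : Differentiable ℝ f)
    (c : ℝ) : T R S k i (fun y => c * f y) = fun x => c * T R S k i f x := by
  funext x
  simp only [T, diffQuot_const_mul hf, fderiv_const_mul (hf x), mul_add, Finset.mul_sum,
    smul_apply, smul_eq_mul]
  congr 1
  exact Finset.sum_congr rfl fun α _ => by ring

theorem T_sum {ι : Type*} (i : Fin m) (s : Finset ι) {f : ι → EuclideanSpace ℝ (Fin m) → ℝ}
    (hf : ∀ a ∈ s, Differentiable ℝ (f a)) :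
    T R S k i (fun y => ∑ a ∈ s, f a y) = fun x => ∑ a ∈ s, T R S k i (f a) x := by
  classical
  induction s using Finset.induction_on with
  | empty => simpa using T_const i 0
  | insert a s ha ih =>
    simp only [Finset.sum_insert ha]
    rw [T_add i (hf a (by simp)) (Differentiable.fun_sum fun b hb => hf b (by simp [hb])),
      ih fun b hb => hf b (by simp [hb])]

theorem T_coord_mul (hS : IsSimpleSystem R S) (hk : IsMultiplicity R k) (i l : Fin m)
    {f : EuclideanSpace ℝ (Fin m) → ℝ} (hf : Differentiable ℝ f) :
    T R S k i (fun y => y l * f y) = fun x => x l * T R S k i f x +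
      (if i = l then f x else 0) +
      ∑ α ∈ R.roots, k α / ‖α‖ ^ 2 * α i * α l * f (refl α x) := by
  funext x
  rw [T_eq_sum_roots hS hk, T_eq_sum_roots hS hk, fderiv_mul_apply' (by fun_prop) hf,
    fderiv_coord, mul_add, Finset.mul_sum,
    Finset.sum_congr rfl fun α hα => by rw [diffQuot_coord_mul (R.ne_zero α hα) hf]]
  rw [add_right_comm _ _ (if i = l then f x else 0), add_assoc (_ + _), ← Finset.sum_add_distrib]
  congr 1
  · simp [eq_comm]
  · exact Finset.sum_congr rfl fun α _ => by ring

/-- The tuple $(T_1,\dots,T_m)$ transforms like a gradient: $w$ permutes the roots, preserves $k$,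
and carries the quotient along $\alpha$ to the one along $w\alpha$. -/
theorem T_comp (hS : IsSimpleSystem R S) (hk : IsMultiplicity R k) (i : Fin m)
    {f : EuclideanSpace ℝ (Fin m) → ℝ} (hf : Differentiable ℝ f)
    {w : EuclideanSpace ℝ (Fin m) ≃ₗᵢ[ℝ] EuclideanSpace ℝ (Fin m)} (hw : w ∈ R.W) :
    T R S k i (fun y => f (w y)) = fun x =>
      ∑ j, w (EuclideanSpace.single i 1) j * T R S k j f (w x) := by
  funext x
  simp only [T_eq_sum_roots hS hk, fderiv_comp_isometry hf, diffQuot_comp hf]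
  simp only [mul_add, Finset.sum_add_distrib]
  congr 1
  · conv_lhs => rw [show w (EuclideanSpace.single i 1) =
      ∑ j, w (EuclideanSpace.single i 1) j • EuclideanSpace.single j (1 : ℝ) by
        ext a; simp [Finset.sum_apply, Pi.single_apply]]
    rw [map_sum]
    simp
  · simp only [Finset.mul_sum]
    rw [Finset.sum_comm]
    refine Finset.sum_nbij (fun α => w α) (fun α hα => R.map_mem_roots hw hα)
      (fun α _ β _ h => w.injective h) (R.W_image hw).ge ?_
    intro α hα
    rw [hk.invariant α hα w hw]
    -- This is $\langle\alpha,e_i\rangle=\langle w\alpha,we_i\rangle$ in coordinates.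
    have : α i = ∑ j, w (EuclideanSpace.single i 1) j * (w α) j := by
      have h := w.inner_map_map α (EuclideanSpace.single i 1)
      rw [EuclideanSpace.inner_single_right] at h
      simpa [PiLp.inner_apply, -LinearIsometryEquiv.inner_map_map] using h.symm
    rw [this]
    simp only [Finset.mul_sum, Finset.sum_mul, Finset.sum_div]
    exact Finset.sum_congr rfl fun j _ => by ring

end Operators

/-! ### Commutation relations among $T_i$, $x_l$, $\Delta_k$ and $W$. -/

section Commutation

variable {m : ℕ} {R : RootSys m} {S : Set (EuclideanSpace ℝ (Fin m))}
  {k : EuclideanSpace ℝ (Fin m) → ℝ}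

theorem T_comp_refl (hS : IsSimpleSystem R S) (hk : IsMultiplicity R k) (i : Fin m)
    {f : EuclideanSpace ℝ (Fin m) → ℝ} (hf : Differentiable ℝ f)
    {α : EuclideanSpace ℝ (Fin m)} (hα : α ∈ R.roots) :
    T R S k i (fun y => f (refl α y)) = fun x => T R S k i f (refl α x) -
      2 * α i / ‖α‖ ^ 2 * ∑ n, α n * T R S k n f (refl α x) := by
  rw [T_comp hS hk i hf (R.refl_mem_W hα)]
  funext x
  simp only [refl_apply_coord, EuclideanSpace.inner_single_right, sub_mul,
    Finset.sum_sub_distrib, real_inner_self_eq_norm_sq, Finset.mul_sum]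
  congr 1
  · simp
  · exact Finset.sum_congr rfl fun n _ => by simp; ring

/-- Apart from $x_lT_iT_jf$, the right side is visibly symmetric in $i$ and $j$, which yields
`T_comm`; its trace over $i=j$ yields `dunklLaplacian_coord_mul`. -/
theorem T_T_coord_mul (hS : IsSimpleSystem R S) (hk : IsMultiplicity R k) (i j l : Fin m)
    {f : EuclideanSpace ℝ (Fin m) → ℝ} (hf : f ∈ polyFun m) (x : EuclideanSpace ℝ (Fin m)) :
    T R S k i (T R S k j fun y => y l * f y) x = x l * T R S k i (T R S k j f) x +
      (if i = l then T R S k j f x else 0) + (if j = l then T R S k i f x else 0) +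
      ∑ α ∈ R.roots, k α / ‖α‖ ^ 2 * α l * (α i * T R S k j f (refl α x) +
        α j * T R S k i f (refl α x) -
        2 * α i * α j / ‖α‖ ^ 2 * ∑ n, α n * T R S k n f (refl α x)) := by
  have hd := differentiable_of_mem_polyFun hf
  have hT := T_mem_polyFun R S k j hf
  have hσ : ∀ α, (fun y => f (refl α y)) ∈ polyFun m := fun α => comp_mem_polyFun hf _
  have hδ : (fun y => if j = l then f y else 0) ∈ polyFun m := by
    split_ifs
    · exact hf
    · exact const_mem_polyFun 0
  have hTδ : T R S k i (fun y => if j = l then f y else 0) =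
      fun y => if j = l then T R S k i f y else 0 := by
    split_ifs
    · rfl
    · exact T_const i 0
  rw [T_coord_mul hS hk j l hd, T_add i, T_add i, T_coord_mul hS hk i l, T_sum i, hTδ]
  · simp only []
    rw [add_right_comm _ (∑ α ∈ R.roots, _), add_assoc (_ + _), ← Finset.sum_add_distrib]
    congr 1
    refine Finset.sum_congr rfl fun α hα => ?_
    rw [T_const_mul i (differentiable_of_mem_polyFun (hσ α)), T_comp_refl hS hk i hd hα]
    ring
  · exact fun α _ => differentiable_of_mem_polyFun (const_mul_mem_polyFun (hσ α) _)
  · exact differentiable_of_mem_polyFun hT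
  · exact differentiable_of_mem_polyFun (coord_mul_mem_polyFun hT l)
  · exact differentiable_of_mem_polyFun hδ
  · exact differentiable_of_mem_polyFun (add_mem_polyFun (coord_mul_mem_polyFun hT l) hδ)
  · exact differentiable_of_mem_polyFun
      (sum_mem_polyFun fun α _ => const_mul_mem_polyFun (hσ α) _)

/-- Dunkl's theorem: the Dunkl derivatives commute on polynomials. -/
theorem T_comm (hS : IsSimpleSystem R S) (hk : IsMultiplicity R k) (i j : Fin m)
    {f : EuclideanSpace ℝ (Fin m) → ℝ} (hf : f ∈ polyFun m) :
    T R S k i (T R S k j f) = T R S k j (T R S k i f) := by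
  induction hf using polyFun_induction with
  | const c => simp only [T_const]
  | add f hf g hg ihf ihg =>
    have h : ∀ i, ∀ f ∈ polyFun m, Differentiable ℝ (T R S k i f) := fun i f hf =>
      differentiable_of_mem_polyFun (T_mem_polyFun R S k i hf)
    have hf' := differentiable_of_mem_polyFun hf
    have hg' := differentiable_of_mem_polyFun hg
    rw [T_add j hf' hg', T_add i hf' hg', T_add i (h j f hf) (h j g hg),
      T_add j (h i f hf) (h i g hg), ihf, ihg]
  | coord_mul l f hf ih =>
    funext x
    rw [T_T_coord_mul hS hk i j l hf, T_T_coord_mul hS hk j i l hf, ih,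
      add_right_comm (x l * _)]
    congr 1
    exact Finset.sum_congr rfl fun α _ => by ring

theorem dunklLaplacian_mem_polyFun {f : EuclideanSpace ℝ (Fin m) → ℝ} (hf : f ∈ polyFun m) :
    dunklLaplacian R S k f ∈ polyFun m :=
  sum_mem_polyFun fun i _ => T_mem_polyFun R S k i (T_mem_polyFun R S k i hf)

theorem dunklLaplacian_const (c : ℝ) :
    dunklLaplacian R S k (fun _ => c) = fun _ => 0 := by
  funext x; simp [dunklLaplacian, T_const]

theorem dunklLaplacian_add {f g : EuclideanSpace ℝ (Fin m) → ℝ} (hf : f ∈ polyFun m)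
    (hg : g ∈ polyFun m) : dunklLaplacian R S k (fun y => f y + g y) =
      fun x => dunklLaplacian R S k f x + dunklLaplacian R S k g x := by
  have h : ∀ i, ∀ f ∈ polyFun m, Differentiable ℝ (T R S k i f) := fun i f hf =>
    differentiable_of_mem_polyFun (T_mem_polyFun R S k i hf)
  funext x
  simp only [dunklLaplacian, ← Finset.sum_add_distrib]
  refine Finset.sum_congr rfl fun i _ => ?_
  rw [T_add i (differentiable_of_mem_polyFun hf) (differentiable_of_mem_polyFun hg),
    T_add i (h i f hf) (h i g hg)]

theorem dunklLaplacian_const_mul {f : EuclideanSpace ℝ (Fin m) → ℝ} (hf : f ∈ polyFun m)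
    (c : ℝ) : dunklLaplacian R S k (fun y => c * f y) =
      fun x => c * dunklLaplacian R S k f x := by
  funext x
  simp only [dunklLaplacian, Finset.mul_sum]
  refine Finset.sum_congr rfl fun i _ => ?_
  rw [T_const_mul i (differentiable_of_mem_polyFun hf),
    T_const_mul i (differentiable_of_mem_polyFun (T_mem_polyFun R S k i hf))]

theorem dunklLaplacian_T (hS : IsSimpleSystem R S) (hk : IsMultiplicity R k) (l : Fin m)
    {f : EuclideanSpace ℝ (Fin m) → ℝ} (hf : f ∈ polyFun m) :
    dunklLaplacian R S k (T R S k l f) = T R S k l (dunklLaplacian R S k f) := by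
  have h := T_sum (R := R) (S := S) (k := k) l Finset.univ
    (f := fun i => T R S k i (T R S k i f))
    (fun i _ => differentiable_of_mem_polyFun (T_mem_polyFun R S k i (T_mem_polyFun R S k i hf)))
  refine Eq.trans ?_ h.symm
  funext x
  refine Finset.sum_congr rfl fun i _ => ?_
  rw [T_comm hS hk i l hf, T_comm hS hk i l (T_mem_polyFun R S k i hf)]

/-- On summing over $i=j$ the reflection terms cancel: for each root,
$2\sum_i\alpha_iT_if(\sigma_\alpha x)$ meets
$(2|\alpha|^2/|\alpha|^2)\sum_n\alpha_nT_nf(\sigma_\alpha x)$. -/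
theorem dunklLaplacian_coord_mul (hS : IsSimpleSystem R S) (hk : IsMultiplicity R k)
    (l : Fin m) {f : EuclideanSpace ℝ (Fin m) → ℝ} (hf : f ∈ polyFun m) :
    dunklLaplacian R S k (fun y => y l * f y) =
      fun x => x l * dunklLaplacian R S k f x + 2 * T R S k l f x := by
  funext x
  simp only [dunklLaplacian, T_T_coord_mul hS hk _ _ l hf, Finset.sum_add_distrib,
    Finset.sum_ite_eq', Finset.mem_univ, if_true, Finset.mul_sum (a := x l)]
  rw [Finset.sum_comm, Finset.sum_eq_zero (s := R.roots), add_zero, two_mul, add_assoc]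
  intro α hα
  have hα' : ‖α‖ ≠ 0 := norm_ne_zero_iff.2 (R.ne_zero α hα)
  rw [← Finset.mul_sum, Finset.sum_sub_distrib, ← Finset.sum_mul, Finset.sum_add_distrib]
  have h : ∑ i, 2 * α i * α i / ‖α‖ ^ 2 = 2 := by
    have h2 : ∑ i, 2 * α i * α i = 2 * ‖α‖ ^ 2 := by
      rw [EuclideanSpace.real_norm_sq_eq, Finset.mul_sum]
      exact Finset.sum_congr rfl fun i _ => by ring
    rw [← Finset.sum_div, h2]
    field_simp
  rw [h]
  ring

theorem dunklLaplacian_comp (hS : IsSimpleSystem R S) (hk : IsMultiplicity R k)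
    {f : EuclideanSpace ℝ (Fin m) → ℝ} (hf : f ∈ polyFun m)
    {w : EuclideanSpace ℝ (Fin m) ≃ₗᵢ[ℝ] EuclideanSpace ℝ (Fin m)} (hw : w ∈ R.W) :
    dunklLaplacian R S k (fun y => f (w y)) = fun x => dunklLaplacian R S k f (w x) := by
  have hT : ∀ i, T R S k i f ∈ polyFun m := fun i => T_mem_polyFun R S k i hf
  -- Rows of the matrix of $w$ are orthonormal, being the images of the standard basis under
  -- $w^{-1}$.
  have horth : ∀ a b, ∑ i, w (EuclideanSpace.single i 1) a * w (EuclideanSpace.single i 1) b =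
      if a = b then 1 else 0 := by
    intro a b
    have e : ∀ i a, w (EuclideanSpace.single i 1) a = w.symm (EuclideanSpace.single a 1) i := by
      intro i a
      have h := w.inner_map_map (EuclideanSpace.single i 1) (w.symm (EuclideanSpace.single a 1))
      rw [w.apply_symm_apply, EuclideanSpace.inner_single_right,
        EuclideanSpace.inner_single_left] at h
      simpa using h
    have h := w.symm.inner_map_map (EuclideanSpace.single b 1) (EuclideanSpace.single a (1 : ℝ))
    rw [EuclideanSpace.inner_single_right] at h
    simp only [e]
    simpa [PiLp.inner_apply, -LinearIsometryEquiv.inner_map_map, Pi.single_apply] using h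
  funext x
  have key : ∀ i, T R S k i (T R S k i fun y => f (w y)) x =
      ∑ a, ∑ b, w (EuclideanSpace.single i 1) a * w (EuclideanSpace.single i 1) b *
        T R S k b (T R S k a f) (w x) := by
    intro i
    rw [T_comp hS hk i (differentiable_of_mem_polyFun hf) hw, T_sum i _ fun a _ =>
      differentiable_of_mem_polyFun (const_mul_mem_polyFun (comp_mem_polyFun (hT a) w) _)]
    refine Finset.sum_congr rfl fun a _ => ?_
    rw [T_const_mul i (differentiable_of_mem_polyFun (comp_mem_polyFun (hT a) w)),
      T_comp hS hk i (differentiable_of_mem_polyFun (hT a)) hw]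
    simp only [Finset.mul_sum]
    exact Finset.sum_congr rfl fun b _ => (mul_assoc _ _ _).symm
  unfold dunklLaplacian
  rw [Finset.sum_congr rfl fun i _ => key i, Finset.sum_comm]
  refine Finset.sum_congr rfl fun a _ => ?_
  rw [Finset.sum_comm]
  simp only [← Finset.sum_mul, horth]
  simp

end Commutation

/-! ### Local nilpotency of $\Delta_k$ and the operator $e^{-\Delta_k/2}$. -/

section Exponential

variable {m : ℕ} {R : RootSys m} {S : Set (EuclideanSpace ℝ (Fin m))}
  {k : EuclideanSpace ℝ (Fin m) → ℝ}

theorem dunklLaplacian_iterate_mem_polyFun {f : EuclideanSpace ℝ (Fin m) → ℝ}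
    (hf : f ∈ polyFun m) (n : ℕ) : (dunklLaplacian R S k)^[n] f ∈ polyFun m := by
  induction n with
  | zero => exact hf
  | succ n ih => rw [Function.iterate_succ_apply']; exact dunklLaplacian_mem_polyFun ih

theorem dunklLaplacian_iterate_zero (n : ℕ) :
    (dunklLaplacian R S k)^[n] (fun _ => 0) = fun _ => 0 := by
  induction n with
  | zero => rfl
  | succ n ih => rw [Function.iterate_succ_apply', ih, dunklLaplacian_const]

theorem dunklLaplacian_iterate_eq_zero_of_le {f : EuclideanSpace ℝ (Fin m) → ℝ} {N n : ℕ}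
    (h : (dunklLaplacian R S k)^[N] f = fun _ => 0) (hn : N ≤ n) :
    (dunklLaplacian R S k)^[n] f = fun _ => 0 := by
  obtain ⟨j, rfl⟩ := Nat.exists_eq_add_of_le' hn
  rw [Function.iterate_add_apply, h, dunklLaplacian_iterate_zero]

theorem dunklLaplacian_iterate_add {f g : EuclideanSpace ℝ (Fin m) → ℝ} (hf : f ∈ polyFun m)
    (hg : g ∈ polyFun m) (n : ℕ) : (dunklLaplacian R S k)^[n] (fun y => f y + g y) =
      fun x => (dunklLaplacian R S k)^[n] f x + (dunklLaplacian R S k)^[n] g x := by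
  induction n with
  | zero => rfl
  | succ n ih =>
    simp only [Function.iterate_succ_apply', ih]
    exact dunklLaplacian_add (dunklLaplacian_iterate_mem_polyFun hf n)
      (dunklLaplacian_iterate_mem_polyFun hg n)

theorem dunklLaplacian_iterate_const_mul {f : EuclideanSpace ℝ (Fin m) → ℝ}
    (hf : f ∈ polyFun m) (c : ℝ) (n : ℕ) : (dunklLaplacian R S k)^[n] (fun y => c * f y) =
      fun x => c * (dunklLaplacian R S k)^[n] f x := by
  induction n with
  | zero => rfl
  | succ n ih =>
    simp only [Function.iterate_succ_apply', ih]
    exact dunklLaplacian_const_mul (dunklLaplacian_iterate_mem_polyFun hf n) c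

theorem dunklLaplacian_iterate_comp (hS : IsSimpleSystem R S) (hk : IsMultiplicity R k)
    {f : EuclideanSpace ℝ (Fin m) → ℝ} (hf : f ∈ polyFun m)
    {w : EuclideanSpace ℝ (Fin m) ≃ₗᵢ[ℝ] EuclideanSpace ℝ (Fin m)} (hw : w ∈ R.W) (n : ℕ) :
    (dunklLaplacian R S k)^[n] (fun y => f (w y)) =
      fun x => (dunklLaplacian R S k)^[n] f (w x) := by
  induction n with
  | zero => rfl
  | succ n ih =>
    simp only [Function.iterate_succ_apply', ih]
    exact dunklLaplacian_comp hS hk (dunklLaplacian_iterate_mem_polyFun hf n) hw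

/-- Since $T_l$ commutes with $\Delta_k$, each further power contributes one more $2T_l\Delta_k^n$.
For $f$ killed by $\Delta_k^N$ it shows that $x_lf$ is killed by $\Delta_k^{N+1}$. -/
theorem dunklLaplacian_iterate_coord_mul (hS : IsSimpleSystem R S) (hk : IsMultiplicity R k)
    (l : Fin m) {f : EuclideanSpace ℝ (Fin m) → ℝ} (hf : f ∈ polyFun m) (n : ℕ) :
    (dunklLaplacian R S k)^[n + 1] (fun y => y l * f y) = fun x =>
      x l * (dunklLaplacian R S k)^[n + 1] f x +
        2 * (n + 1) * T R S k l ((dunklLaplacian R S k)^[n] f) x := by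
  induction n with
  | zero => simpa using dunklLaplacian_coord_mul hS hk l hf
  | succ n ih =>
    have h := dunklLaplacian_iterate_mem_polyFun (R := R) (S := S) (k := k) hf
    have hT := T_mem_polyFun R S k l (h n)
    rw [Function.iterate_succ_apply', ih, dunklLaplacian_add (coord_mul_mem_polyFun (h _) l)
      (const_mul_mem_polyFun hT _), dunklLaplacian_coord_mul hS hk l (h _),
      dunklLaplacian_const_mul hT, dunklLaplacian_T hS hk l (h n)]
    funext x
    simp only [← Function.iterate_succ_apply' (dunklLaplacian R S k)]
    push_cast
    ring

/-- The Dunkl Laplacian is locally nilpotent on polynomials. -/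
theorem exists_dunklLaplacian_iterate_eq_zero (hS : IsSimpleSystem R S)
    (hk : IsMultiplicity R k) {f : EuclideanSpace ℝ (Fin m) → ℝ} (hf : f ∈ polyFun m) :
    ∃ N, (dunklLaplacian R S k)^[N] f = fun _ => 0 := by
  induction hf using polyFun_induction with
  | const c => exact ⟨1, dunklLaplacian_const c⟩
  | add f hf g hg ihf ihg =>
    obtain ⟨M, hM⟩ := ihf
    obtain ⟨N, hN⟩ := ihg
    refine ⟨max M N, ?_⟩
    rw [dunklLaplacian_iterate_add hf hg,
      dunklLaplacian_iterate_eq_zero_of_le hM (le_max_left _ _),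
      dunklLaplacian_iterate_eq_zero_of_le hN (le_max_right _ _)]
    simp
  | coord_mul l f hf ih =>
    obtain ⟨N, hN⟩ := ih
    refine ⟨N + 1, ?_⟩
    rw [dunklLaplacian_iterate_coord_mul hS hk l hf,
      dunklLaplacian_iterate_eq_zero_of_le hN N.le_succ, hN, T_const]
    simp

/-- `e^{-Δ_k/2} f` for a function `f`, as a pointwise series. -/
noncomputable def expLap (R : RootSys m) (S : Set (EuclideanSpace ℝ (Fin m)))
    (k : EuclideanSpace ℝ (Fin m) → ℝ) (f : EuclideanSpace ℝ (Fin m) → ℝ)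
    (x : EuclideanSpace ℝ (Fin m)) : ℝ :=
  ∑' n : ℕ, (-1 / 2 : ℝ) ^ n / (n.factorial : ℝ) * (dunklLaplacian R S k)^[n] f x

theorem expLap_eq_sum {f : EuclideanSpace ℝ (Fin m) → ℝ} {N : ℕ}
    (h : (dunklLaplacian R S k)^[N] f = fun _ => 0) :
    expLap R S k f = fun x => ∑ n ∈ Finset.range N,
      (-1 / 2 : ℝ) ^ n / (n.factorial : ℝ) * (dunklLaplacian R S k)^[n] f x := by
  funext x
  refine tsum_eq_sum fun n hn => ?_
  rw [dunklLaplacian_iterate_eq_zero_of_le h (by simpa using hn), mul_zero]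

theorem expLap_mem_polyFun (hS : IsSimpleSystem R S) (hk : IsMultiplicity R k)
    {f : EuclideanSpace ℝ (Fin m) → ℝ} (hf : f ∈ polyFun m) : expLap R S k f ∈ polyFun m := by
  obtain ⟨N, hN⟩ := exists_dunklLaplacian_iterate_eq_zero hS hk hf
  rw [expLap_eq_sum hN]
  exact sum_mem_polyFun fun n _ =>
    const_mul_mem_polyFun (dunklLaplacian_iterate_mem_polyFun hf n) _

theorem expLap_const (c : ℝ) : expLap R S k (fun _ => c) = fun _ => c := by
  rw [expLap_eq_sum (N := 1) (dunklLaplacian_const c)]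
  simp

theorem expLap_add (hS : IsSimpleSystem R S) (hk : IsMultiplicity R k)
    {f g : EuclideanSpace ℝ (Fin m) → ℝ} (hf : f ∈ polyFun m) (hg : g ∈ polyFun m) :
    expLap R S k (fun y => f y + g y) = fun x => expLap R S k f x + expLap R S k g x := by
  obtain ⟨M, hM⟩ := exists_dunklLaplacian_iterate_eq_zero hS hk hf
  obtain ⟨N, hN⟩ := exists_dunklLaplacian_iterate_eq_zero hS hk hg
  have hM' := dunklLaplacian_iterate_eq_zero_of_le hM (le_max_left M N)
  have hN' := dunklLaplacian_iterate_eq_zero_of_le hN (le_max_right M N)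
  rw [expLap_eq_sum hM', expLap_eq_sum hN', expLap_eq_sum (N := max M N)
    (by rw [dunklLaplacian_iterate_add hf hg, hM', hN']; simp)]
  simp only [dunklLaplacian_iterate_add hf hg, mul_add, Finset.sum_add_distrib]

theorem expLap_const_mul {f : EuclideanSpace ℝ (Fin m) → ℝ} (hf : f ∈ polyFun m) (c : ℝ) :
    expLap R S k (fun y => c * f y) = fun x => c * expLap R S k f x := by
  funext x
  simp only [expLap, dunklLaplacian_iterate_const_mul hf, mul_left_comm _ c, tsum_mul_left]

theorem expLap_sum (hS : IsSimpleSystem R S) (hk : IsMultiplicity R k) {ι : Type*}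
    (s : Finset ι) {f : ι → EuclideanSpace ℝ (Fin m) → ℝ} (hf : ∀ a ∈ s, f a ∈ polyFun m) :
    expLap R S k (fun y => ∑ a ∈ s, f a y) = fun x => ∑ a ∈ s, expLap R S k (f a) x := by
  classical
  induction s using Finset.induction_on with
  | empty => simpa using expLap_const 0
  | insert a s ha ih =>
    simp only [Finset.sum_insert ha]
    rw [expLap_add hS hk (hf a (by simp)) (sum_mem_polyFun fun b hb => hf b (by simp [hb])),
      ih fun b hb => hf b (by simp [hb])]

theorem expLap_comp (hS : IsSimpleSystem R S) (hk : IsMultiplicity R k)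
    {f : EuclideanSpace ℝ (Fin m) → ℝ} (hf : f ∈ polyFun m)
    {w : EuclideanSpace ℝ (Fin m) ≃ₗᵢ[ℝ] EuclideanSpace ℝ (Fin m)} (hw : w ∈ R.W) :
    expLap R S k (fun y => f (w y)) = fun x => expLap R S k f (w x) := by
  funext x
  simp only [expLap, dunklLaplacian_iterate_comp hS hk hf hw]

/-- `e^{-Δ_k/2} x_l = (x_l - T_l) e^{-Δ_k/2}`. -/
theorem expLap_coord_mul (hS : IsSimpleSystem R S) (hk : IsMultiplicity R k)
    (l : Fin m) {f : EuclideanSpace ℝ (Fin m) → ℝ} (hf : f ∈ polyFun m) :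
    expLap R S k (fun y => y l * f y) =
      fun x => x l * expLap R S k f x - T R S k l (expLap R S k f) x := by
  obtain ⟨N, hN⟩ := exists_dunklLaplacian_iterate_eq_zero hS hk hf
  have hN' := dunklLaplacian_iterate_eq_zero_of_le hN N.le_succ
  have hmem := dunklLaplacian_iterate_mem_polyFun (R := R) (S := S) (k := k) hf
  have hT : T R S k l (expLap R S k f) = fun x => ∑ n ∈ Finset.range N,
      (-1 / 2 : ℝ) ^ n / (n.factorial : ℝ) *
        T R S k l ((dunklLaplacian R S k)^[n] f) x := by
    rw [expLap_eq_sum hN, T_sum l _ fun n _ =>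
      differentiable_of_mem_polyFun (const_mul_mem_polyFun (hmem n) _)]
    simp only [T_const_mul l (differentiable_of_mem_polyFun (hmem _))]
  rw [hT, expLap_eq_sum hN', expLap_eq_sum (N := N + 1) (by
    rw [dunklLaplacian_iterate_coord_mul hS hk l hf, hN', hN, T_const]; simp)]
  funext x
  -- Splitting off the term $n=0$ shifts the index, so that the commutator formula for
  -- $\Delta_k^{n+1}$ applies. The coefficients then match:
  -- $\frac{(-1/2)^{n+1}}{(n+1)!}\,2(n+1)=-\frac{(-1/2)^n}{n!}$.
  simp only [Finset.sum_range_succ' _ N, dunklLaplacian_iterate_coord_mul hS hk l hf,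
    Function.iterate_zero, id, mul_add, Finset.sum_add_distrib, Finset.mul_sum]
  rw [add_sub_right_comm, ← Finset.sum_sub_distrib, ← Finset.sum_add_distrib]
  congr 1
  · refine Finset.sum_congr rfl fun n _ => ?_
    have h1 : (n.factorial : ℝ) ≠ 0 := by positivity
    have h2 : (n : ℝ) + 1 ≠ 0 := by positivity
    rw [Nat.factorial_succ, pow_succ]
    push_cast
    field_simp
    ring
  · ring

end Exponential

/-! ### The Rodrigues formula and averaging over $W$. -/

section Rodrigues

variable {m : ℕ} {R : RootSys m} {S : Set (EuclideanSpace ℝ (Fin m))}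
  {k : EuclideanSpace ℝ (Fin m) → ℝ}

theorem hasFDerivAt_gaussian (x : EuclideanSpace ℝ (Fin m)) :
    HasFDerivAt (fun y : EuclideanSpace ℝ (Fin m) => Real.exp (-‖y‖ ^ 2 / 2))
      (-Real.exp (-‖x‖ ^ 2 / 2) • innerSL ℝ x) x := by
  have h := ((hasStrictFDerivAt_norm_sq x).hasFDerivAt.neg.mul_const (1 / 2 : ℝ)).exp
  refine (h.congr_fderiv ?_).congr_of_eventuallyEq (.of_forall fun y => ?_)
  · ext v
    simp [div_eq_mul_inv]
  · simp [div_eq_mul_inv]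

theorem differentiable_gaussian :
    Differentiable ℝ fun y : EuclideanSpace ℝ (Fin m) => Real.exp (-‖y‖ ^ 2 / 2) :=
  fun x => (hasFDerivAt_gaussian x).differentiableAt

theorem fderiv_gaussian (x v : EuclideanSpace ℝ (Fin m)) :
    fderiv ℝ (fun y : EuclideanSpace ℝ (Fin m) => Real.exp (-‖y‖ ^ 2 / 2)) x v =
      -(Real.exp (-‖x‖ ^ 2 / 2) * ⟪x, v⟫) := by
  simp [(hasFDerivAt_gaussian x).fderiv]

/-- A radial factor passes through every difference quotient; only $\partial_i$ sees it and produces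
$-x_i$. -/
theorem T_gaussian_mul (i : Fin m) {f : EuclideanSpace ℝ (Fin m) → ℝ}
    (hf : Differentiable ℝ f) :
    T R S k i (fun y => Real.exp (-‖y‖ ^ 2 / 2) * f y) =
      fun x => Real.exp (-‖x‖ ^ 2 / 2) * (T R S k i f x - x i * f x) := by
  funext x
  have h : ∀ α, diffQuot α (fun y => Real.exp (-‖y‖ ^ 2 / 2) * f y) x =
      Real.exp (-‖x‖ ^ 2 / 2) * diffQuot α f x := fun α =>
    diffQuot_mul_of_invariant hf differentiable_gaussian (by simp) x fun hx => by
      rw [fderiv_gaussian, real_inner_comm, hx]; simp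
  simp only [T, h, fderiv_mul_apply' differentiable_gaussian hf, fderiv_gaussian,
    EuclideanSpace.inner_single_right]
  rw [mul_sub, mul_add, Finset.mul_sum,
    Finset.sum_congr rfl fun α _ => mul_left_comm (k α * α i) _ _]
  simp
  ring

/-- The functions $G\,c\,e^{-\Delta_k/2}f$ are stable under $T_i$; the scalar $c$ is there to
collect the signs under iteration. -/
theorem T_gaussian_mul_expLap (hS : IsSimpleSystem R S) (hk : IsMultiplicity R k) (i : Fin m)
    {f : EuclideanSpace ℝ (Fin m) → ℝ} (hf : f ∈ polyFun m) (c : ℝ) :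
    T R S k i (fun y => Real.exp (-‖y‖ ^ 2 / 2) * (c * expLap R S k f y)) =
      fun x => Real.exp (-‖x‖ ^ 2 / 2) * (-c * expLap R S k (fun y => y i * f y) x) := by
  have hE := expLap_mem_polyFun hS hk hf
  rw [T_gaussian_mul i (differentiable_of_mem_polyFun (const_mul_mem_polyFun hE c)),
    T_const_mul i (differentiable_of_mem_polyFun hE), expLap_coord_mul hS hk i hf]
  funext x
  ring

theorem T_iterate_gaussian_mul_expLap (hS : IsSimpleSystem R S) (hk : IsMultiplicity R k)
    (i : Fin m) {f : EuclideanSpace ℝ (Fin m) → ℝ} (hf : f ∈ polyFun m) (c : ℝ) (n : ℕ) :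
    (T R S k i)^[n] (fun y => Real.exp (-‖y‖ ^ 2 / 2) * (c * expLap R S k f y)) =
      fun x => Real.exp (-‖x‖ ^ 2 / 2) *
        ((-1) ^ n * c * expLap R S k (fun y => y i ^ n * f y) x) := by
  induction n with
  | zero => simp
  | succ n ih =>
    have h : (fun y : EuclideanSpace ℝ (Fin m) => y i ^ n * f y) ∈ polyFun m :=
      mul_mem (pow_mem (coord_mem_polyFun i) n) hf
    rw [Function.iterate_succ_apply', ih, T_gaussian_mul_expLap hS hk i h]
    simp only [pow_succ', mul_assoc, neg_mul, one_mul]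

theorem foldr_T_gaussian (hS : IsSimpleSystem R S) (hk : IsMultiplicity R k) (ν : Fin m → ℕ)
    (l : List (Fin m)) :
    l.foldr (fun i g => (T R S k i)^[ν i] g) (fun z => Real.exp (-‖z‖ ^ 2 / 2)) =
      fun x => Real.exp (-‖x‖ ^ 2 / 2) * ((-1) ^ (l.map ν).sum *
        expLap R S k (fun y => (l.map fun i => y i ^ ν i).prod) x) := by
  induction l with
  | nil => simp [expLap_const]
  | cons i l ih =>
    have h : (fun y : EuclideanSpace ℝ (Fin m) => (l.map fun i => y i ^ ν i).prod) ∈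
        polyFun m := by
      clear ih
      induction l with
      | nil => simpa using const_mem_polyFun 1
      | cons j l ih =>
        simp only [List.map_cons, List.prod_cons]
        exact mul_mem (pow_mem (coord_mem_polyFun j) (ν j)) ih
    rw [List.foldr_cons, ih, T_iterate_gaussian_mul_expLap hS hk i h]
    simp [pow_add]

theorem monomialT_gaussian (hS : IsSimpleSystem R S) (hk : IsMultiplicity R k)
    (ν : Fin m →₀ ℕ) :
    monomialT R S k ν (fun z => Real.exp (-‖z‖ ^ 2 / 2)) =
      fun x => Real.exp (-‖x‖ ^ 2 / 2) * ((-1) ^ (∑ i, ν i) *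
        expLap R S k (fun y => ∏ i, y i ^ ν i) x) := by
  rw [monomialT, foldr_T_gaussian hS hk ν]
  simp only [← List.ofFn_eq_map, List.sum_ofFn, List.prod_ofFn]

/-- The Rodrigues formula: `p(T) e^{-|x|²/2} = (-1)^n e^{-|x|²/2} e^{-Δ_k/2} p` for `p`
homogeneous of degree `n`. -/
theorem polyT_gaussian (hS : IsSimpleSystem R S) (hk : IsMultiplicity R k)
    {p : MvPolynomial (Fin m) ℝ} {n : ℕ} (hp : p.IsHomogeneous n)
    (x : EuclideanSpace ℝ (Fin m)) :
    polyT R S k p (fun z => Real.exp (-‖z‖ ^ 2 / 2)) x =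
      (-1) ^ n * (Real.exp (-‖x‖ ^ 2 / 2) * expNegHalfLaplacian R S k p x) := by
  have hmon : ∀ ν : Fin m →₀ ℕ,
      (fun y : EuclideanSpace ℝ (Fin m) => ∏ i, y i ^ ν i) ∈ polyFun m := fun ν =>
    prod_mem_polyFun fun i _ => pow_mem (coord_mem_polyFun i) (ν i)
  have hE : expNegHalfLaplacian R S k p x = ∑ ν ∈ p.support, p.coeff ν *
      expLap R S k (fun y => ∏ i, y i ^ ν i) x := by
    change expLap R S k (fun y => MvPolynomial.eval (fun i => y i) p) x = _
    simp only [MvPolynomial.eval_eq']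
    rw [expLap_sum hS hk _ fun ν _ => const_mul_mem_polyFun (hmon ν) _]
    simp only [expLap_const_mul (hmon _)]
  rw [hE, polyT, Finset.mul_sum, Finset.mul_sum]
  refine Finset.sum_congr rfl fun ν hν => ?_
  -- Homogeneity gives every monomial the same sign, which can therefore leave the sum.
  have hdeg : ∑ i, ν i = n := by
    have := hp (MvPolynomial.mem_support_iff.1 hν)
    simpa [Finsupp.weight_apply, Finsupp.sum_fintype] using this
  rw [monomialT_gaussian hS hk, hdeg]
  ring

theorem polyComp_isHomogeneous
    (w : EuclideanSpace ℝ (Fin m) ≃ₗᵢ[ℝ] EuclideanSpace ℝ (Fin m))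
    {p : MvPolynomial (Fin m) ℝ} {n : ℕ} (hp : p.IsHomogeneous n) :
    (polyComp w p).IsHomogeneous n := by
  have h := hp.aeval (fun i => ∑ j, MvPolynomial.C (w (EuclideanSpace.single j 1) i) *
    (MvPolynomial.X j : MvPolynomial (Fin m) ℝ)) (n := 1) fun i =>
      MvPolynomial.IsHomogeneous.sum _ _ _ fun j _ =>
        (MvPolynomial.isHomogeneous_X ℝ j).C_mul _
  rwa [one_mul] at h

theorem polyW_isHomogeneous (R : RootSys m) {p : MvPolynomial (Fin m) ℝ} {n : ℕ}
    (hp : p.IsHomogeneous n) : (polyW R p).IsHomogeneous n := by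
  rw [polyW, MvPolynomial.smul_eq_C_mul]
  exact (MvPolynomial.IsHomogeneous.sum _ _ _ fun w _ =>
    polyComp_isHomogeneous w.1 hp).C_mul _

theorem expNegHalfLaplacian_polyW (hS : IsSimpleSystem R S) (hk : IsMultiplicity R k)
    (p : MvPolynomial (Fin m) ℝ) (x : EuclideanSpace ℝ (Fin m)) :
    expNegHalfLaplacian R S k (polyW R p) x =
      (Fintype.card R.W : ℝ)⁻¹ * ∑ w : R.W, expNegHalfLaplacian R S k p (w.1 x) := by
  have hp := eval_mem_polyFun p
  have hw : ∀ w : R.W, (fun y => MvPolynomial.eval (fun i => w.1 y i) p) ∈ polyFun m :=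
    fun w => comp_mem_polyFun hp w.1
  -- Passing to functions makes linearity and `expLap_comp` available.
  change expLap R S k (fun y => MvPolynomial.eval (fun i => y i) (polyW R p)) x = _
  simp only [polyW, MvPolynomial.smul_eval, map_sum, eval_polyComp]
  rw [expLap_const_mul (sum_mem_polyFun fun w _ => hw w), expLap_sum hS hk _ fun w _ => hw w]
  exact congrArg _ (Finset.sum_congr rfl fun w _ => congrFun (expLap_comp hS hk hp w.2) x)

theorem hermiteW_eq (hS : IsSimpleSystem R S) (hk : IsMultiplicity R k)
    (φ : (Fin m → ℕ) → MvPolynomial (Fin m) ℝ) (τ : Fin m → ℕ) :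
    hermiteW R S k φ τ = expNegHalfLaplacian R S k (polyW R (φ τ)) :=
  funext fun x => (expNegHalfLaplacian_polyW hS hk (φ τ) x).symm

end Rodrigues

end Dunkl

theorem mainTheorem7 {m : ℕ} (R : Dunkl.RootSys m) (S : Set (EuclideanSpace ℝ (Fin m)))
    (hS : Dunkl.IsSimpleSystem R S) (k : EuclideanSpace ℝ (Fin m) → ℝ)
    (hk : Dunkl.IsMultiplicity R k) (φ : (Fin m → ℕ) → MvPolynomial (Fin m) ℝ)
    (hφ : Dunkl.IsHomogeneousOrthogonalBasis R S k φ) (τ : Fin m → ℕ) :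
    IntegrableOn (fun y => Real.exp (-‖y‖ ^ 2 / 2) * Dunkl.hermiteW R S k φ τ y *
      ∏ α ∈ Dunkl.posRoots R S, ⟪α, y⟫) (Dunkl.chamber R S) ∧
    IntegrableOn (fun y =>
      Dunkl.polyT R S k (Dunkl.polyW R (φ τ)) (fun z => Real.exp (-‖z‖ ^ 2 / 2)) y *
      ∏ α ∈ Dunkl.posRoots R S, ⟪α, y⟫) (Dunkl.chamber R S) ∧
    Dunkl.coeffW R S k φ τ =
      (2 : ℝ) ^ (-((∑ i, τ i : ℕ) : ℝ) / 2) * ((-1) ^ (∑ i, τ i) *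
        ∫ y in Dunkl.chamber R S,
          Dunkl.polyT R S k (Dunkl.polyW R (φ τ)) (fun z => Real.exp (-‖z‖ ^ 2 / 2)) y *
          ∏ α ∈ Dunkl.posRoots R S, ⟪α, y⟫) := by
  -- The whole proposition at the level of integrands; the sign is its own inverse.
  have hrod : ∀ y, Dunkl.polyT R S k (Dunkl.polyW R (φ τ))
      (fun z => Real.exp (-‖z‖ ^ 2 / 2)) y * ∏ α ∈ Dunkl.posRoots R S, ⟪α, y⟫ =
      (-1) ^ (∑ i, τ i) * (Real.exp (-‖y‖ ^ 2 / 2) * Dunkl.hermiteW R S k φ τ y *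
        ∏ α ∈ Dunkl.posRoots R S, ⟪α, y⟫) := fun y => by
    rw [Dunkl.polyT_gaussian hS hk (Dunkl.polyW_isHomogeneous R (hφ.homogeneous τ)),
      Dunkl.hermiteW_eq hS hk, mul_assoc]
  -- Integrability holds on the whole space and restricts to the chamber.
  have hint : Integrable fun y => Real.exp (-‖y‖ ^ 2 / 2) * Dunkl.hermiteW R S k φ τ y *
      ∏ α ∈ Dunkl.posRoots R S, ⟪α, y⟫ := by
    have h : (fun y => Dunkl.hermiteW R S k φ τ y * ∏ α ∈ Dunkl.posRoots R S, ⟪α, y⟫) ∈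
        Dunkl.polyFun m := by
      rw [Dunkl.hermiteW_eq hS hk]
      exact mul_mem (Dunkl.expLap_mem_polyFun hS hk (Dunkl.eval_mem_polyFun _))
        (Dunkl.prod_mem_polyFun fun α _ => Dunkl.inner_mem_polyFun α)
    simpa only [mul_assoc] using Dunkl.integrable_gaussian_mul_of_mem_polyFun h
  refine ⟨hint.integrableOn, ?_, ?_⟩
  · simp only [hrod]
    exact (hint.const_mul _).integrableOn
  · simp only [hrod]
    rw [integral_const_mul, ← mul_assoc ((-1 : ℝ) ^ _), ← mul_pow, neg_one_mul, neg_neg, one_pow,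
      one_mul, Dunkl.coeffW]
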